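/- Let $T\ge 1$ and $d\ge 1$ be integers, and let $x=(x_1,\dots,x_T)$ be a random vector with values in $(\mathbb{R}^d)^T$. Write $\|\cdot\|_\infty$ for the sup norm on $(\mathbb{R}^d)^T$. Let $x^1,x^2,\dots$ be independent random vectors, each with the same distribution as $x$. Let $g:(\{1,\dots,T\}\cup\{\infty\})\times(\mathbb{R}^d)^T\to[0,\infty)$ be a reward function with each $g(t,\cdot)$ measurable and $g(\infty,\cdot)\equiv 0$. A collection of exercise policies is a tuple $\mu=(\mu_1,\dots,\mu_T)$ of measurable functions $\mu_t:\mathbb{R}^d\to\{\mathrm{Stop},\mathrm{Continue}\}$; its Markovian stopping rule is $\tau_\mu(y)=\min\{t\in\{1,\dots,T\}:\mu_t(y_t)=\mathrm{Stop}\}$, with $\min\emptyset=\infty$. For $N\ge 1$ and $\epsilon\ge 0$ put $$J^*(\mu)=\mathbb{E}\big[g(\tau_\mu(x),x)\big],\qquad \widehat J_{N,\epsilon}(\mu)=\frac1N\sum_{i=1}^N\ \inf_{y\in(\mathbb{R}^d)^T:\ \|y-x^i\|_\infty\le\epsilon} g(\tau_\mu(y),x^i).$$ Assume: 1. (Continuity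 of rewards) $\lim_{\epsilon\to0^+}\Delta_\epsilon(x)=0$ almost surely, where $\Delta_\epsilon(x)=\min_{t\in\{1,\dots,T\}}\Big\{\inf_{y:\ \|y-x\|_\infty\le\epsilon}g(t,y)-g(t,x)\Big\}$. 2. (Light tails) $\mathbb{E}\big[\exp(\|x\|_\infty^a)\big]<\infty$ for some $a>1$. 3. (Bounded rewards) There is a constant $U$ with $0\le g(t,y)\le U$ for all $t\in\{1,\dots,T\}$ and $y\in(\mathbb{R}^d)^T$. Then, almost surely, the following limit exists and satisfies $$\lim_{\epsilon\to0^+}\ \liminf_{N\to\infty}\ \inf_{\mu}\Big\{J^*(\mu)-\widehat J_{N,\epsilon}(\mu)\Big\}\ \ge\ 0,$$ where the infimum is over all collections of exercise policies. -/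

import Mathlib

open MeasureTheory ProbabilityTheory Filter Topology

namespace OptimalStopping

noncomputable section

/-- A state trajectory `(x_1, …, x_T)` with states in `ℝ^d`. The norm on this type is the sup norm
over all periods and all coordinates. -/
abbrev StatePath (T d : ℕ) : Type := Fin T → Fin d → ℝ

/-- A collection of exercise policies: for each period `t` a measurable map from the state space to
`{stop, continue}`, where `true` stands for "stop" and `false` for "continue". -/
structure Policy (T d : ℕ) : Type where
  act : Fin T → (Fin d → ℝ) → Bool
  measurable_act : ∀ t, Measurable (act t)

/-- The Markovian stopping rule `τ_μ(x)`: the first period at which the policy stops, and `⊤`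
(playing the role of `∞`) if it never stops. -/
def stoppingTime {T d : ℕ} (μ : Policy T d) (x : StatePath T d) : WithTop (Fin T) :=
  (Finset.univ.filter fun t : Fin T => μ.act t (x t) = true).min

/-- The uncertainty set of radius `ε` around the trajectory `x`. -/
def uncertaintySet {T d : ℕ} (ε : ℝ) (x : StatePath T d) : Set (StatePath T d) :=
  {y | ‖y - x‖ ≤ ε}

/-- For `ε ≥ 0` the uncertainty set is the product over the periods of the sup-norm balls. -/
theorem mem_uncertaintySet_iff {T d : ℕ} {ε : ℝ} (hε : 0 ≤ ε) (x y : StatePath T d) :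
    y ∈ uncertaintySet ε x ↔ ∀ t, ‖y t - x t‖ ≤ ε := by
  simp only [uncertaintySet, Set.mem_ofPred_eq, pi_norm_le_iff_of_nonneg hε, Pi.sub_apply]

/-- The expected reward `J*(μ) = E[g(τ_μ(x), x)]`, where `ν` is the law of `x`. -/
def expectedReward {T d : ℕ} (g : WithTop (Fin T) → StatePath T d → ℝ) (ν : Measure (StatePath T d))
    (μ : Policy T d) : ℝ :=
  ∫ x, g (stoppingTime μ x) x ∂ν

/-- The robust objective value of the policies `μ` on the first `N` of the sample paths
`x 0, x 1, …`, namely the average over these paths of `inf_{y ∈ U^i} g(τ_μ(y), x^i)`. -/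
def robustReward {T d : ℕ} (g : WithTop (Fin T) → StatePath T d → ℝ) (x : ℕ → StatePath T d)
    (N : ℕ) (ε : ℝ) (μ : Policy T d) : ℝ :=
  (1 / (N : ℝ)) * ∑ i ∈ Finset.range N, ⨅ y : uncertaintySet ε (x i), g (stoppingTime μ y) (x i)

/-- `Δ_ε(x)`: the minimum over the periods `t` of `inf_{‖y - x‖ ≤ ε} g(t, y) - g(t, x)`. -/
def rewardDrop {T d : ℕ} (g : WithTop (Fin T) → StatePath T d → ℝ) (ε : ℝ) (x : StatePath T d) : ℝ :=
  ⨅ t : Fin T, ((⨅ y : uncertaintySet ε x, g t y) - g t x)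

end

end OptimalStopping

open OptimalStopping

namespace OptimalStopping

/-! Cut path space into cubes of side `ε`. Any two paths in a cube are within `ε`, so the robust
infimum at `x` is at most the least reward at `x` over all stopping times that the policy realizes
on the cube of `x` (`iInf_uncertaintySet_le_minReward`). This bound sees the policy only through one
subset of the finite set of stopping times per cube, and its mean is at most the expected reward.
Finitely many cubes carry almost all the mass, so the law of large numbers for finitely many
functions is uniform over all policies (`eventually_le_iInf`). Monotonicity in `ε` gives the limit
and reduces the almost sure statement to countably many radii. -/

variable {T d : ℕ}

/-! ### Grid cells and the stopping times realized on them -/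

/-- The smallest reward at the trajectory `x` among the stopping times in `S`. -/
noncomputable def minReward (g : WithTop (Fin T) → StatePath T d → ℝ) (S : Set (WithTop (Fin T)))
    (x : StatePath T d) : ℝ :=
  ⨅ t : S, g t x

/-- The cell containing `x` of the grid of mesh `ε`. -/
noncomputable def gridCell (ε : ℝ) (x : StatePath T d) : Fin T → Fin d → ℤ :=
  fun t j => ⌊x t j / ε⌋

/-- The stopping times that the policy `μ` realizes on a cell of the grid of mesh `ε`. -/
def cellTimes (ε : ℝ) (μ : Policy T d) (k : Fin T → Fin d → ℤ) : Set (WithTop (Fin T)) :=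
  {t | ∃ y, gridCell ε y = k ∧ stoppingTime μ y = t}

theorem measurable_gridCell (ε : ℝ) : Measurable (gridCell (T := T) (d := d) ε) := by
  refine measurable_pi_lambda _ fun t => measurable_pi_lambda _ fun j => ?_
  exact Int.measurable_floor.comp (by fun_prop)

theorem mem_uncertaintySet_of_gridCell_eq {ε : ℝ} (hε : 0 < ε) {x y : StatePath T d}
    (h : gridCell ε y = gridCell ε x) : y ∈ uncertaintySet ε x := by
  rw [mem_uncertaintySet_iff hε.le]
  intro t
  rw [pi_norm_le_iff_of_nonneg hε.le]
  intro j
  have h1 := Int.abs_sub_lt_one_of_floor_eq_floor (congrFun (congrFun h t) j)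
  rw [← sub_div, abs_div, abs_of_pos hε, div_lt_one hε] at h1
  exact h1.le

/-- The stopping time factors through the finite discrete space of action vectors. -/
theorem measurableSet_stoppingTime_eq (μ : Policy T d) (t : WithTop (Fin T)) :
    MeasurableSet (stoppingTime μ ⁻¹' {t}) := by
  have h : Measurable fun x : StatePath T d => fun t : Fin T => μ.act t (x t) :=
    measurable_pi_lambda _ fun t => (μ.measurable_act t).comp (measurable_pi_apply t)
  have hB : MeasurableSet {b : Fin T → Bool | (Finset.univ.filter fun s => b s = true).min = t} :=
    .of_discrete
  exact h hB

/-! ### Bounds on cellwise minimal, robust and expected rewards -/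

section Reward

variable {g : WithTop (Fin T) → StatePath T d → ℝ} {U : ℝ}

theorem minReward_nonneg (hg0 : ∀ t y, 0 ≤ g t y) (S : Set (WithTop (Fin T)))
    (x : StatePath T d) : 0 ≤ minReward g S x :=
  Real.iInf_nonneg fun t => hg0 t x

theorem minReward_le_of_mem (hg0 : ∀ t y, 0 ≤ g t y) {S : Set (WithTop (Fin T))}
    {t : WithTop (Fin T)} (ht : t ∈ S) (x : StatePath T d) : minReward g S x ≤ g t x :=
  ciInf_le (f := fun t : S => g t x) ⟨0, by rintro _ ⟨t, rfl⟩; exact hg0 t x⟩ ⟨t, ht⟩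

theorem minReward_le (hg0 : ∀ t y, 0 ≤ g t y) (hgU : ∀ t y, g t y ≤ U)
    (S : Set (WithTop (Fin T))) (x : StatePath T d) : minReward g S x ≤ U := by
  rcases S.eq_empty_or_nonempty with rfl | ⟨t, ht⟩
  -- The real infimum over the empty set is `0`.
  · simpa [minReward] using (hg0 ⊤ x).trans (hgU ⊤ x)
  · exact (minReward_le_of_mem hg0 ht x).trans (hgU t x)

theorem measurable_minReward (hg : ∀ t, Measurable (g t)) (S : Set (WithTop (Fin T))) :
    Measurable (minReward g S) :=
  Measurable.iInf fun t : S => hg t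

theorem measurable_reward_stoppingTime (hg : ∀ t, Measurable (g t)) (μ : Policy T d) :
    Measurable fun x => g (stoppingTime μ x) x := by
  have h : (fun x => g (stoppingTime μ x) x) = fun x =>
      ∑ t : WithTop (Fin T), Set.indicator (stoppingTime μ ⁻¹' {t}) (g t) x := by
    ext x
    rw [Finset.sum_eq_single (stoppingTime μ x)]
    · simp
    · intro t _ ht
      exact Set.indicator_of_notMem (fun h => ht (by simpa using h.symm)) _
    · simp
  rw [h]
  exact Finset.measurable_sum _ fun t _ => (hg t).indicator (measurableSet_stoppingTime_eq μ t)

theorem iInf_uncertaintySet_le (hg0 : ∀ t y, 0 ≤ g t y) {ε : ℝ} {x y : StatePath T d}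
    (hy : y ∈ uncertaintySet ε x) (μ : Policy T d) :
    ⨅ y : uncertaintySet ε x, g (stoppingTime μ y) x ≤ g (stoppingTime μ y) x :=
  ciInf_le (f := fun y : uncertaintySet ε x => g (stoppingTime μ y) x)
    ⟨0, by rintro _ ⟨t, rfl⟩; exact hg0 _ x⟩ ⟨y, hy⟩

theorem iInf_uncertaintySet_le_minReward (hg0 : ∀ t y, 0 ≤ g t y) {ε : ℝ} (hε : 0 < ε)
    (μ : Policy T d) (x : StatePath T d) :
    ⨅ y : uncertaintySet ε x, g (stoppingTime μ y) x ≤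
      minReward g (cellTimes ε μ (gridCell ε x)) x := by
  have : Nonempty (cellTimes ε μ (gridCell ε x)) := ⟨_, x, rfl, rfl⟩
  refine le_ciInf ?_
  rintro ⟨_, y, hy, rfl⟩
  exact iInf_uncertaintySet_le hg0 (mem_uncertaintySet_of_gridCell_eq hε hy) μ

theorem iInf_uncertaintySet_anti (hg0 : ∀ t y, 0 ≤ g t y) {ε ε' : ℝ} (hε : 0 < ε) (h : ε ≤ ε')
    (μ : Policy T d) (x : StatePath T d) :
    ⨅ y : uncertaintySet ε' x, g (stoppingTime μ y) x ≤
      ⨅ y : uncertaintySet ε x, g (stoppingTime μ y) x := by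
  have : Nonempty (uncertaintySet ε x) := ⟨x, by simpa [uncertaintySet] using hε.le⟩
  exact le_ciInf fun y => iInf_uncertaintySet_le hg0 (le_trans (show ‖y.1 - x‖ ≤ ε from y.2) h) μ

theorem robustReward_anti (hg0 : ∀ t y, 0 ≤ g t y) (x : ℕ → StatePath T d) (N : ℕ) {ε ε' : ℝ}
    (hε : 0 < ε) (h : ε ≤ ε') (μ : Policy T d) :
    robustReward g x N ε' μ ≤ robustReward g x N ε μ :=
  mul_le_mul_of_nonneg_left
    (Finset.sum_le_sum fun i _ => iInf_uncertaintySet_anti hg0 hε h μ (x i)) (by positivity)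

theorem robustReward_nonneg (hg0 : ∀ t y, 0 ≤ g t y) (x : ℕ → StatePath T d) (N : ℕ) (ε : ℝ)
    (μ : Policy T d) : 0 ≤ robustReward g x N ε μ :=
  mul_nonneg (by positivity) (Finset.sum_nonneg fun _ _ => Real.iInf_nonneg fun _ => hg0 _ _)

theorem robustReward_le (hg0 : ∀ t y, 0 ≤ g t y) (hgU : ∀ t y, g t y ≤ U)
    (x : ℕ → StatePath T d) (N : ℕ) {ε : ℝ} (hε : 0 < ε) (μ : Policy T d) :
    robustReward g x N ε μ ≤ U := by
  have hU : 0 ≤ U := (hg0 ⊤ (x 0)).trans (hgU ⊤ (x 0))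
  have h : ∑ i ∈ Finset.range N, ⨅ y : uncertaintySet ε (x i), g (stoppingTime μ y) (x i) ≤
      ∑ _i ∈ Finset.range N, U :=
    Finset.sum_le_sum fun i _ => (iInf_uncertaintySet_le_minReward hg0 hε μ (x i)).trans
      (minReward_le hg0 hgU _ _)
  rw [Finset.sum_const, Finset.card_range, nsmul_eq_mul] at h
  -- For `N = 0` the average is `0`, since `1 / 0 = 0`.
  rcases N.eq_zero_or_pos with rfl | hN
  · simpa [robustReward] using hU
  · rw [robustReward, one_div, inv_mul_le_iff₀ (by exact_mod_cast hN)]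
    exact h

variable {ν : Measure (StatePath T d)}

theorem expectedReward_nonneg (hg0 : ∀ t y, 0 ≤ g t y) (μ : Policy T d) :
    0 ≤ expectedReward g ν μ :=
  integral_nonneg fun _ => hg0 _ _

variable [IsProbabilityMeasure ν]

theorem integrable_reward_stoppingTime (hg : ∀ t, Measurable (g t)) (hg0 : ∀ t y, 0 ≤ g t y)
    (hgU : ∀ t y, g t y ≤ U) (μ : Policy T d) :
    Integrable (fun x => g (stoppingTime μ x) x) ν :=
  Integrable.of_bound (measurable_reward_stoppingTime hg μ).aestronglyMeasurable U
    (Eventually.of_forall fun x => by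
      rw [Real.norm_of_nonneg (hg0 _ _)]; exact hgU _ _)

theorem expectedReward_le (hg : ∀ t, Measurable (g t)) (hg0 : ∀ t y, 0 ≤ g t y)
    (hgU : ∀ t y, g t y ≤ U) (μ : Policy T d) : expectedReward g ν μ ≤ U := by
  simpa [expectedReward] using integral_mono (integrable_reward_stoppingTime (ν := ν) hg hg0 hgU μ)
    (integrable_const U) fun x => hgU _ _

/-! ### Decomposition over cells and uniform comparison -/

/-- The restriction of `minReward` to one cell of the grid. -/
noncomputable def cellReward (g : WithTop (Fin T) → StatePath T d → ℝ) (ε : ℝ)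
    (k : Fin T → Fin d → ℤ) (S : Set (WithTop (Fin T))) : StatePath T d → ℝ :=
  Set.indicator (gridCell ε ⁻¹' {k}) (minReward g S)

theorem cellReward_nonneg (hg0 : ∀ t y, 0 ≤ g t y) (ε : ℝ) (k : Fin T → Fin d → ℤ)
    (S : Set (WithTop (Fin T))) (x : StatePath T d) : 0 ≤ cellReward g ε k S x :=
  Set.indicator_nonneg (fun x _ => minReward_nonneg hg0 S x) x

theorem cellReward_le (hg0 : ∀ t y, 0 ≤ g t y) (hgU : ∀ t y, g t y ≤ U) (ε : ℝ)
    (k : Fin T → Fin d → ℤ) (S : Set (WithTop (Fin T))) (x : StatePath T d) :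
    cellReward g ε k S x ≤ U :=
  Set.indicator_apply_le' (fun _ => minReward_le hg0 hgU S x)
    (fun _ => (hg0 ⊤ x).trans (hgU ⊤ x))

theorem measurable_cellReward (hg : ∀ t, Measurable (g t)) (ε : ℝ) (k : Fin T → Fin d → ℤ)
    (S : Set (WithTop (Fin T))) : Measurable (cellReward g ε k S) :=
  (measurable_minReward hg S).indicator (measurable_gridCell ε (measurableSet_singleton k))

theorem integrable_cellReward (hg : ∀ t, Measurable (g t)) (hg0 : ∀ t y, 0 ≤ g t y)
    (hgU : ∀ t y, g t y ≤ U) (ε : ℝ) (k : Fin T → Fin d → ℤ) (S : Set (WithTop (Fin T))) :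
    Integrable (cellReward g ε k S) ν :=
  Integrable.of_bound (measurable_cellReward hg ε k S).aestronglyMeasurable U
    (Eventually.of_forall fun x => by
      rw [Real.norm_of_nonneg (cellReward_nonneg hg0 ε k S x)]
      exact cellReward_le hg0 hgU ε k S x)

theorem sum_cellReward_of_mem (ε : ℝ) (S : (Fin T → Fin d → ℤ) → Set (WithTop (Fin T)))
    {F : Finset (Fin T → Fin d → ℤ)} {x : StatePath T d} (hx : gridCell ε x ∈ F) :
    ∑ k ∈ F, cellReward g ε k (S k) x = minReward g (S (gridCell ε x)) x := by
  rw [Finset.sum_eq_single_of_mem _ hx]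
  · simp [cellReward]
  · intro k _ hk
    exact Set.indicator_of_notMem (fun h => hk (by simpa using h.symm)) _

theorem sum_cellReward_of_notMem (ε : ℝ) (S : (Fin T → Fin d → ℤ) → Set (WithTop (Fin T)))
    {F : Finset (Fin T → Fin d → ℤ)} {x : StatePath T d} (hx : gridCell ε x ∉ F) :
    ∑ k ∈ F, cellReward g ε k (S k) x = 0 :=
  Finset.sum_eq_zero fun k hk =>
    Set.indicator_of_notMem (fun h => hx (by
      have h' : gridCell ε x = k := h
      rwa [h'])) _

/-- The time realized at `x` itself belongs to the set of its cell; outside `F` the reward is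
nonnegative. -/
theorem sum_integral_cellReward_le (hg : ∀ t, Measurable (g t)) (hg0 : ∀ t y, 0 ≤ g t y)
    (hgU : ∀ t y, g t y ≤ U) (ε : ℝ) (F : Finset (Fin T → Fin d → ℤ)) (μ : Policy T d) :
    ∑ k ∈ F, ∫ x, cellReward g ε k (cellTimes ε μ k) x ∂ν ≤ expectedReward g ν μ := by
  rw [← integral_finsetSum _ fun k _ => integrable_cellReward hg hg0 hgU ε k _]
  refine integral_mono (integrable_finsetSum _ fun k _ => integrable_cellReward hg hg0 hgU ε k _)
    (integrable_reward_stoppingTime hg hg0 hgU μ) fun x => ?_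
  by_cases hx : gridCell ε x ∈ F
  · simp only [sum_cellReward_of_mem ε (cellTimes ε μ) hx]
    exact minReward_le_of_mem hg0
      (show stoppingTime μ x ∈ cellTimes ε μ (gridCell ε x) from ⟨x, rfl, rfl⟩) x
  · simp only [sum_cellReward_of_notMem ε (cellTimes ε μ) hx]
    exact hg0 _ _

/-- Each sample outside the cells of `F` costs at most `U`. -/
theorem robustReward_le_sum (hg0 : ∀ t y, 0 ≤ g t y)
    (hgU : ∀ t y, g t y ≤ U) {ε : ℝ} (hε : 0 < ε) (F : Finset (Fin T → Fin d → ℤ))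
    (x : ℕ → StatePath T d) (N : ℕ) (μ : Policy T d) :
    robustReward g x N ε μ ≤
      ∑ k ∈ F, (∑ i ∈ Finset.range N, cellReward g ε k (cellTimes ε μ k) (x i)) / N +
        U * ((∑ i ∈ Finset.range N,
          Set.indicator (gridCell ε ⁻¹' (F : Set (Fin T → Fin d → ℤ))ᶜ) 1 (x i)) / N) := by
  rw [← Finset.sum_div, Finset.sum_comm, ← mul_div_assoc, ← add_div, Finset.mul_sum,
    ← Finset.sum_add_distrib, robustReward, one_div, inv_mul_eq_div]
  refine div_le_div_of_nonneg_right (Finset.sum_le_sum fun i _ => ?_) (by positivity)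
  refine (iInf_uncertaintySet_le_minReward hg0 hε μ (x i)).trans ?_
  by_cases hx : gridCell ε (x i) ∈ F
  · rw [sum_cellReward_of_mem ε (cellTimes ε μ) hx]
    simp [hx]
  · rw [sum_cellReward_of_notMem ε (cellTimes ε μ) hx]
    simpa [hx] using minReward_le hg0 hgU _ _

/-- Continuity from above: the complements decrease to the empty set as `F` grows through the finite
sets of the countable grid. -/
theorem exists_finset_measureReal_compl_lt (ν : Measure (StatePath T d)) [IsProbabilityMeasure ν]
    (ε : ℝ) {δ : ℝ} (hδ : 0 < δ) :
    ∃ F : Finset (Fin T → Fin d → ℤ),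
      ν.real (gridCell ε ⁻¹' (F : Set (Fin T → Fin d → ℤ))ᶜ) < δ := by
  have h := tendsto_measure_iInter_atTop (μ := ν)
    (s := fun F : Finset (Fin T → Fin d → ℤ) => gridCell ε ⁻¹' (F : Set (Fin T → Fin d → ℤ))ᶜ)
    (fun F => (measurable_gridCell ε F.measurableSet.compl).nullMeasurableSet)
    (fun F F' hFF' x hx hx' => hx (hFF' hx')) ⟨∅, measure_ne_top _ _⟩
  have h0 : ⋂ F : Finset (Fin T → Fin d → ℤ),
      gridCell (T := T) (d := d) ε ⁻¹' (F : Set (Fin T → Fin d → ℤ))ᶜ = ∅ :=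
    Set.eq_empty_of_forall_notMem fun x hx =>
      Set.mem_iInter.1 hx {gridCell ε x} (Finset.mem_coe.2 (Finset.mem_singleton_self _))
  rw [h0, measure_empty] at h
  have h' := (ENNReal.tendsto_toReal ENNReal.zero_ne_top).comp h
  exact (h'.eventually_lt_const hδ).exists

/-- If the empirical averages along `z` converge for every cell of the grid of mesh `ε`, then the
robust rewards asymptotically underestimate the expected rewards uniformly over the policies. -/
theorem eventually_le_iInf (hg : ∀ t, Measurable (g t)) (hg0 : ∀ t y, 0 ≤ g t y)
    (hgU : ∀ t y, g t y ≤ U) {ε : ℝ} (hε : 0 < ε) (z : ℕ → StatePath T d)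
    (hcell : ∀ k S, Tendsto (fun N : ℕ => (∑ i ∈ Finset.range N, cellReward g ε k S (z i)) / N)
      atTop (𝓝 (∫ x, cellReward g ε k S x ∂ν)))
    (hcompl : ∀ F : Finset (Fin T → Fin d → ℤ), Tendsto (fun N : ℕ => (∑ i ∈ Finset.range N,
      Set.indicator (gridCell ε ⁻¹' (F : Set (Fin T → Fin d → ℤ))ᶜ)
        (1 : StatePath T d → ℝ) (z i)) / N)
      atTop (𝓝 (ν.real (gridCell ε ⁻¹' (F : Set (Fin T → Fin d → ℤ))ᶜ))))
    {η : ℝ} (hη : 0 < η) :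
    ∀ᶠ N : ℕ in atTop, -η ≤ ⨅ μ : Policy T d, (expectedReward g ν μ - robustReward g z N ε μ) := by
  have hU : 0 ≤ U := (hg0 ⊤ (z 0)).trans (hgU ⊤ (z 0))
  -- Half of `η` pays for the tail, the other half is shared by the cells of `F`; each `+ 1` keeps a
  -- denominator positive.
  obtain ⟨F, hF⟩ := exists_finset_measureReal_compl_lt ν ε
    (show 0 < η / (2 * (U + 1)) by positivity)
  -- Quantifying over all `S`, of which there are finitely many, makes the threshold on `N`
  -- independent of the policy.
  have h1 : ∀ᶠ N : ℕ in atTop, ∀ k ∈ F, ∀ S : Set (WithTop (Fin T)),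
      (∑ i ∈ Finset.range N, cellReward g ε k S (z i)) / N ≤
        ∫ x, cellReward g ε k S x ∂ν + η / (2 * (F.card + 1)) := by
    rw [Filter.eventually_all_finset]
    intro k _
    rw [Filter.eventually_all]
    intro S
    exact (hcell k S).eventually_le_const (lt_add_of_pos_right _ (by positivity))
  filter_upwards [h1, (hcompl F).eventually_lt_const hF] with N hN hN'
  have : Nonempty (Policy T d) := ⟨⟨fun _ _ => true, fun _ => measurable_const⟩⟩
  refine le_ciInf fun μ => ?_
  have h2 := sum_integral_cellReward_le (ν := ν) hg hg0 hgU ε F μ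
  have h3 := robustReward_le_sum hg0 hgU hε F z N μ
  have h4 := Finset.sum_le_sum fun k hk => hN k hk (cellTimes ε μ k)
  rw [Finset.sum_add_distrib, Finset.sum_const, nsmul_eq_mul] at h4
  have h5 : (F.card : ℝ) * (η / (2 * (F.card + 1))) ≤ η / 2 := by
    rw [mul_div_assoc', div_le_div_iff₀ (by positivity) (by positivity)]
    nlinarith
  have h6 := mul_le_mul_of_nonneg_left hN'.le hU
  have h7 : U * (η / (2 * (U + 1))) ≤ η / 2 := by
    rw [mul_div_assoc', div_le_div_iff₀ (by positivity) (by positivity)]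
    nlinarith
  linarith

end Reward

/-! ### Law of large numbers on all cells -/

/-- The strong law of large numbers for a bounded function of i.i.d. samples. -/
theorem tendsto_average_ae {Ω E : Type*} [MeasurableSpace Ω] [MeasurableSpace E] {P : Measure Ω}
    {ν : Measure E} [IsProbabilityMeasure ν] {x : ℕ → Ω → E} (hx_meas : ∀ i, Measurable (x i))
    (hx_law : ∀ i, P.map (x i) = ν) (hx_indep : iIndepFun x P) {f : E → ℝ} (hf : Measurable f)
    (hfi : Integrable f ν) :
    ∀ᵐ ω ∂P, Tendsto (fun N : ℕ => (∑ i ∈ Finset.range N, f (x i ω)) / N) atTop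
      (𝓝 (∫ y, f y ∂ν)) := by
  have hint : Integrable (fun ω => f (x 0 ω)) P :=
    Integrable.comp_measurable (by rwa [hx_law 0]) (hx_meas 0)
  have h := strong_law_ae_real (fun i ω => f (x i ω)) hint
    (fun i j hij => (hx_indep.indepFun hij).comp hf hf)
    (fun i => IdentDistrib.comp
      ⟨(hx_meas i).aemeasurable, (hx_meas 0).aemeasurable, by rw [hx_law, hx_law]⟩ hf)
  have h0 : ∫ y, f y ∂ν = ∫ ω, f (x 0 ω) ∂P := by
    rw [← hx_law 0, integral_map (hx_meas 0).aemeasurable hf.aestronglyMeasurable]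
  rwa [h0]

/-- Cells, sets of stopping times and finite sets of cells are all countable in number, so one null
set suffices. -/
theorem ae_tendsto_cell_averages {Ω : Type*} [MeasurableSpace Ω] {P : Measure Ω}
    {ν : Measure (StatePath T d)} [IsProbabilityMeasure ν] {x : ℕ → Ω → StatePath T d}
    (hx_meas : ∀ i, Measurable (x i)) (hx_law : ∀ i, P.map (x i) = ν) (hx_indep : iIndepFun x P)
    {g : WithTop (Fin T) → StatePath T d → ℝ} {U : ℝ} (hg : ∀ t, Measurable (g t))
    (hg0 : ∀ t y, 0 ≤ g t y) (hgU : ∀ t y, g t y ≤ U) (ε : ℝ) :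
    ∀ᵐ ω ∂P,
      (∀ k S, Tendsto (fun N : ℕ => (∑ i ∈ Finset.range N, cellReward g ε k S (x i ω)) / N)
        atTop (𝓝 (∫ x, cellReward g ε k S x ∂ν))) ∧
      ∀ F : Finset (Fin T → Fin d → ℤ), Tendsto (fun N : ℕ => (∑ i ∈ Finset.range N,
        Set.indicator (gridCell ε ⁻¹' (F : Set (Fin T → Fin d → ℤ))ᶜ)
          (1 : StatePath T d → ℝ) (x i ω)) / N)
        atTop (𝓝 (ν.real (gridCell ε ⁻¹' (F : Set (Fin T → Fin d → ℤ))ᶜ))) := by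
  refine Filter.Eventually.and ?_ ?_
  · simp only [ae_all_iff]
    exact fun k S => tendsto_average_ae hx_meas hx_law hx_indep (measurable_cellReward hg ε k S)
      (integrable_cellReward hg hg0 hgU ε k S)
  · rw [ae_all_iff]
    intro F
    have hF : MeasurableSet (gridCell (T := T) (d := d) ε ⁻¹' (F : Set (Fin T → Fin d → ℤ))ᶜ) :=
      measurable_gridCell ε F.measurableSet.compl
    rw [← integral_indicator_one hF]
    exact tendsto_average_ae hx_meas hx_law hx_indep (measurable_one.indicator hF)
      ((integrable_const (1 : ℝ)).indicator hF)

end OptimalStopping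

/-! ### Passage to the limit in the radius -/

theorem theorem3 {T d : ℕ} {Ω : Type*} [MeasurableSpace Ω]
    -- the law of the stochastic process and the i.i.d. sample paths drawn from it
    (P : Measure Ω) [IsProbabilityMeasure P]
    (ν : Measure (StatePath T d)) [IsProbabilityMeasure ν]
    (x : ℕ → Ω → StatePath T d)
    (hx_meas : ∀ i, Measurable (x i))
    (hx_law : ∀ i, P.map (x i) = ν)
    (hx_indep : iIndepFun x P)
    -- the reward function
    (g : WithTop (Fin T) → StatePath T d → ℝ)
    (hg_meas : ∀ t : Fin T, Measurable (g t))
    (hg_never : ∀ y, g ⊤ y = 0)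
    -- continuity of the rewards
    (hcont : ∀ᵐ y ∂ν, Tendsto (fun ε : ℝ => rewardDrop g ε y) (𝓝[>] 0) (𝓝 0))
    -- light tails
    (htail : ∃ a : ℝ, 1 < a ∧ Integrable (fun y : StatePath T d => Real.exp (‖y‖ ^ a)) ν)
    -- bounded rewards
    (U : ℝ) (hbound : ∀ (t : Fin T) (y : StatePath T d), 0 ≤ g t y ∧ g t y ≤ U) :
    ∀ᵐ ω ∂P, ∃ L : ℝ, 0 ≤ L ∧
      Tendsto
        (fun ε : ℝ => liminf
          (fun N : ℕ => ⨅ μ : Policy T d,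
            (expectedReward g ν μ - robustReward g (fun i => x i ω) N ε μ)) atTop)
        (𝓝[>] 0) (𝓝 L) := by
  have hg : ∀ t, Measurable (g t) := fun t => by
    induction t using WithTop.recTopCoe with
    | top => rw [funext hg_never]; exact measurable_const
    | coe t => exact hg_meas t
  have hg0 : ∀ t y, 0 ≤ g t y := fun t y => by
    induction t using WithTop.recTopCoe with
    | top => exact (hg_never y).ge
    | coe t => exact (hbound t y).1
  -- The absolute value matters when `T = 0`, where `hbound` is vacuous and `U` may be negative.
  have hgU : ∀ t y, g t y ≤ |U| := fun t y => by
    induction t using WithTop.recTopCoe with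
    | top => rw [hg_never]; exact abs_nonneg U
    | coe t => exact (hbound t y).2.trans (le_abs_self U)
  have hne : Nonempty (Policy T d) := ⟨⟨fun _ _ => true, fun _ => measurable_const⟩⟩
  have hae := ae_all_iff.2 fun n : ℕ =>
    ae_tendsto_cell_averages hx_meas hx_law hx_indep hg hg0 hgU (1 / ((n : ℝ) + 1))
  filter_upwards [hae] with ω hω
  set z : ℕ → StatePath T d := fun i => x i ω
  set G : ℝ → ℕ → ℝ := fun ε N => ⨅ μ : Policy T d,
    (expectedReward g ν μ - robustReward g z N ε μ)
  have hlow : ∀ {ε : ℝ}, 0 < ε → ∀ (N : ℕ) (μ : Policy T d),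
      -|U| ≤ expectedReward g ν μ - robustReward g z N ε μ := fun hε N μ => by
    have h1 := expectedReward_nonneg (ν := ν) hg0 μ
    have h2 := robustReward_le hg0 hgU z N hε μ
    linarith
  have hbdd : ∀ {ε : ℝ}, 0 < ε → ∀ N : ℕ, BddBelow (Set.range fun μ : Policy T d =>
      expectedReward g ν μ - robustReward g z N ε μ) := fun hε N =>
    ⟨-|U|, by rintro _ ⟨μ, rfl⟩; exact hlow hε N μ⟩
  have hGlow : ∀ {ε : ℝ}, 0 < ε → ∀ N, -|U| ≤ G ε N := fun hε N => le_ciInf (hlow hε N)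
  have hGup : ∀ {ε : ℝ}, 0 < ε → ∀ N, G ε N ≤ |U| := fun {ε} hε N => by
    obtain ⟨μ⟩ := hne
    have h1 := expectedReward_le (ν := ν) hg hg0 hgU μ
    have h2 := robustReward_nonneg hg0 z N ε μ
    exact (ciInf_le (hbdd hε N) μ).trans (by linarith)
  have hGmono : ∀ {ε ε' : ℝ}, 0 < ε → ε ≤ ε' → ∀ N, G ε N ≤ G ε' N := fun {ε ε'} hε h N =>
    ciInf_mono (hbdd hε N) fun μ => sub_le_sub_left (robustReward_anti hg0 z N hε h μ) _
  -- A real `liminf` is meaningful only for bounded sequences.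
  have hGb : ∀ {ε : ℝ}, 0 < ε → IsBoundedUnder (· ≥ ·) atTop (G ε) := fun hε =>
    isBoundedUnder_of ⟨-|U|, hGlow hε⟩
  have hGc : ∀ {ε : ℝ}, 0 < ε → IsCoboundedUnder (· ≥ ·) atTop (G ε) := fun hε =>
    (isBoundedUnder_of ⟨|U|, hGup hε⟩ : IsBoundedUnder (· ≤ ·) atTop (G _)).isCoboundedUnder_ge
  have hmono : MonotoneOn (fun ε => liminf (G ε) atTop) (Set.Ioi 0) := fun ε hε ε' hε' h =>
    liminf_le_liminf (Eventually.of_forall (hGmono hε h)) (hGb hε) (hGc hε')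
  have hpos : ∀ ε ∈ Set.Ioi (0 : ℝ), 0 ≤ liminf (G ε) atTop := by
    intro ε hε
    -- Shrinking the radius lowers the `liminf`, so a radius `1 / (n + 1)` from the countable family
    -- suffices.
    obtain ⟨n, hn⟩ := exists_nat_one_div_lt (Set.mem_Ioi.1 hε)
    have hn0 : (0 : ℝ) < 1 / ((n : ℝ) + 1) := by positivity
    refine le_trans ?_ (hmono hn0 hε hn.le)
    refine le_of_forall_pos_le_add fun η hη => ?_
    have h := le_liminf_of_le (hGc hn0)
      (eventually_le_iInf (ν := ν) hg hg0 hgU hn0 z (hω n).1 (hω n).2 hη)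
    linarith
  -- A monotone function bounded below on `(0, ∞)` tends to its infimum at `0⁺`.
  have hlim := hmono.tendsto_nhdsGT ⟨0, by rintro _ ⟨ε, hε, rfl⟩; exact hpos ε hε⟩
  exact ⟨_, le_csInf (Set.nonempty_Ioi.image _) (by rintro _ ⟨ε, hε, rfl⟩; exact hpos ε hε), hlim⟩
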